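/- Conventions. A polynomial in one real variable is said to have positive coefficients if none of its coefficients is negative. $\mathbb N=\{0,1,2,\dots\}$, and definable means definable with parameters. Let $\mathcal S$ be an o-minimal expansion of the real field: every definable subset of $\mathbb R$ is a finite union of points and open intervals. An FD-filtration on $\mathcal S$ is a family $\Omega=\{\Omega_{\mathcal F,D}\}_{\mathcal F,D\in\mathbb N}$ of collections of definable subsets of the spaces $\mathbb R^\ell$ such that $\Omega_{\mathcal F,D}\subset\Omega_{\mathcal F+1,D}\cap\Omega_{\mathcal F,D+1}$ for all $\mathcal F,D$, and every definable set belongs to some $\Omega_{\mathcal F,D}$. Subsets of different spaces $\mathbb R^\ell$ are regarded as distinct. A set $X\in\Omega_{\mathcal F,D}$ is said to have format $\mathcal F$ and degree $D$. The pair $\Sigma=(\mathcal S,\Omega)$ is a presharp structure if for every $\mathcal F\in\mathbb N$ there is a polynomial $P_{\mathcal F}$ with positive coefficients such that the following hold. 1. If $A\subset\mathbb R$ and $A\in\Omega_{\mathcal F,D}$, then $A$ has at most $P_{\mathcal F}(D)$ connected components. 2. If $A\subset\mathbb R^\ell$ and $A\in\Omega_{\mathcal F,D}$, then $\mathcal F\ge\ell$.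 3. If $A\subset\mathbb R^\ell$ and $A\in\Omega_{\mathcal F,D}$, then $A^c$, $A\times\mathbb R$, $\mathbb R\times A$ and (if $\ell\ge1$) $\pi_{\ell-1}(A)$ belong to $\Omega_{\mathcal F+1,D}$, where $\pi_{\ell-1}$ is the projection to the first $\ell-1$ coordinates. 4. If $A_1,A_2\subset\mathbb R^\ell$ and $A_i\in\Omega_{\mathcal F_i,D_i}$ for $i=1,2$, then $A_1\cup A_2$ and $A_1\cap A_2$ belong to $\Omega_{\max\{\mathcal F_1,\mathcal F_2\}+1,\,D_1+D_2}$. 5. If $P\in\mathbb R[x_1,\dots,x_\ell]$, then $\{P=0\}\in\Omega_{\ell,\deg P}$ (with total degree, and $\deg 0=0$). **Proposition.** Let $\Sigma=(\mathcal S,\Omega)$ be a presharp structure. For every $\mathcal F\in\mathbb N$ there is a polynomial $Q_{\mathcal F}$ with positive coefficients, depending only on $\mathcal F$ and $\Sigma$, such that for all $D,\ell\in\mathbb N$, every set $X\subset\mathbb R^\ell$ of format $\mathcal F$ and degree $D$ has finitely many connected components, and their number is at most $Q_{\mathcal F}(D)$. -/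

import Mathlib

universe u v

namespace Presharp

/-- A point `{a}` of the real line, or an open interval `(a, b)` with endpoints in `ℝ ∪ {±∞}`. -/
def IsPointOrInterval (J : Set ℝ) : Prop :=
  (∃ a : ℝ, J = {a}) ∨ ∃ a b : EReal, J = {x : ℝ | a < (x : EReal) ∧ (x : EReal) < b}

/-- The first-order structure on `ℝ` given by the language `L` is an o-minimal expansion of the
real field. Definability is always with parameters from `ℝ`. The order need not be mentioned
separately: `x ≤ y` holds exactly when `y - x` is a square. -/
structure IsOMinimalExpansion (L : FirstOrder.Language.{u, v}) [L.Structure ℝ] : Prop where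
  definable_add : (Set.univ : Set ℝ).Definable L {x : Fin 3 → ℝ | x 0 + x 1 = x 2}
  definable_mul : (Set.univ : Set ℝ).Definable L {x : Fin 3 → ℝ | x 0 * x 1 = x 2}
  finite_union : ∀ A : Set ℝ, (Set.univ : Set ℝ).Definable₁ L A →
    ∃ T : Set (Set ℝ), T.Finite ∧ (∀ J ∈ T, IsPointOrInterval J) ∧ A = ⋃₀ T

/-- A doubly indexed family of collections of subsets of the spaces `ℝ^ℓ`:
`A ∈ Ω F D ℓ` means that `A ⊆ ℝ^ℓ` has format `F` and degree `D`. -/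
abbrev Family : Type := ℕ → ℕ → (ℓ : ℕ) → Set (Set (Fin ℓ → ℝ))

/-- `Ω` is an FD-filtration on the structure given by `L` on `ℝ`. -/
structure IsFDFiltration (L : FirstOrder.Language.{u, v}) [L.Structure ℝ] (Ω : Family) :
    Prop where
  definable : ∀ F D ℓ (A : Set (Fin ℓ → ℝ)), A ∈ Ω F D ℓ → (Set.univ : Set ℝ).Definable L A
  mono : ∀ F D ℓ, Ω F D ℓ ⊆ Ω (F + 1) D ℓ ∩ Ω F (D + 1) ℓ
  exhaustive : ∀ ℓ (A : Set (Fin ℓ → ℝ)), (Set.univ : Set ℝ).Definable L A →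
    ∃ F D, A ∈ Ω F D ℓ

/-- `π(A)`, for `π : ℝ^(ℓ+1) → ℝ^ℓ` the projection to the first `ℓ` coordinates. -/
def proj {ℓ : ℕ} (A : Set (Fin (ℓ + 1) → ℝ)) : Set (Fin ℓ → ℝ) :=
  (fun x i => x (Fin.castSucc i)) '' A

/-- `A × ℝ`. -/
def prodR {ℓ : ℕ} (A : Set (Fin ℓ → ℝ)) : Set (Fin (ℓ + 1) → ℝ) :=
  {x | (fun i => x (Fin.castSucc i)) ∈ A}

/-- `ℝ × A`. -/
def Rprod {ℓ : ℕ} (A : Set (Fin ℓ → ℝ)) : Set (Fin (ℓ + 1) → ℝ) :=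
  {x | (fun i => x (Fin.succ i)) ∈ A}

/-- `X` has finitely many connected components, and their number is at most `N`. -/
def HasAtMostComponents {ℓ : ℕ} (X : Set (Fin ℓ → ℝ)) (N : ℝ) : Prop :=
  Finite (ConnectedComponents X) ∧ (Nat.card (ConnectedComponents X) : ℝ) ≤ N

/-- A polynomial with positive coefficients (monomials that do not occur have coefficient `0`). -/
def PositiveCoeffs (P : Polynomial ℝ) : Prop := ∀ i, 0 ≤ P.coeff i

/-- The pair of the structure given by `L` on `ℝ` and of the family `Ω` is a presharp structure. -/
structure IsPresharp (L : FirstOrder.Language.{u, v}) [L.Structure ℝ] (Ω : Family) : Prop where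
  oMinimal : IsOMinimalExpansion L
  filtration : IsFDFiltration L Ω
  components : ∀ F, ∃ P : Polynomial ℝ, PositiveCoeffs P ∧
    ∀ D, ∀ A ∈ Ω F D 1, HasAtMostComponents A (P.eval (D : ℝ))
  le_format : ∀ F D ℓ, ∀ A ∈ Ω F D ℓ, ℓ ≤ F
  proj_mem : ∀ F D ℓ, ∀ A ∈ Ω F D (ℓ + 1), proj A ∈ Ω (F + 1) D ℓ
  compl_mem : ∀ F D ℓ, ∀ A ∈ Ω F D ℓ, Aᶜ ∈ Ω (F + 1) D ℓ
  prodR_mem : ∀ F D ℓ, ∀ A ∈ Ω F D ℓ, prodR A ∈ Ω (F + 1) D (ℓ + 1)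
  Rprod_mem : ∀ F D ℓ, ∀ A ∈ Ω F D ℓ, Rprod A ∈ Ω (F + 1) D (ℓ + 1)
  union_mem : ∀ F₁ D₁ F₂ D₂ ℓ, ∀ A₁ ∈ Ω F₁ D₁ ℓ, ∀ A₂ ∈ Ω F₂ D₂ ℓ,
    A₁ ∪ A₂ ∈ Ω (max F₁ F₂ + 1) (D₁ + D₂) ℓ
  inter_mem : ∀ F₁ D₁ F₂ D₂ ℓ, ∀ A₁ ∈ Ω F₁ D₁ ℓ, ∀ A₂ ∈ Ω F₂ D₂ ℓ,
    A₁ ∩ A₂ ∈ Ω (max F₁ F₂ + 1) (D₁ + D₂) ℓ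
  zeroSet_mem : ∀ ℓ (P : MvPolynomial (Fin ℓ) ℝ),
    {x : Fin ℓ → ℝ | MvPolynomial.eval x P = 0} ∈ Ω ℓ P.totalDegree ℓ

end Presharp

/-!
The number of components is bounded on locally closed pieces of `X` by counting local minima of
distance functions. If `Y` is closed and a locally constant function on `Y` takes the values
`c₁, …, c_m`, then its level sets are disjoint closed sets, and a generic point `p` has different
distances to them (`exists_injective_infDist`). These distances are attained, and they are local
minimum values on `Y` of the squared distance to `p`. A function on a separable metric space has
only countably many local minimum values (`countable_localMinValues`), and the components of a
countable set are points. So `m` is at most the number of components of a subset of `ℝ^1`, which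
is obtained from `Y` by a fixed first-order formula (`piecesLE_of_isClosed`) and is therefore bounded
by a polynomial in the degree. That first-order formulas respect formats and degrees is the
calculus of tame families.

If `X` is not closed, its frontier `∂X = closure X \ X` is taken into account. The points of `X` at
which `X` is locally closed are those outside the closure of `∂X`; they are exhausted by the closed
sets `{x ∈ X | d(x, ∂X)² ≥ ε}`, to which the argument above applies uniformly in `ε`
(`piecesLE_sdiff_badPart`). The remaining points form the set `badPart X`, and the argument is
repeated for it. This stops after `n + 1` steps in `ℝ^n`, because the dimension drops in each
step (`IsPresharp.badPart_iterate_eq_empty`).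

The drop of the dimension is the only fact about o-minimal structures that is needed. Cell
decomposition is avoided: since the structure lives on `ℝ`, Baire's theorem shows that definable
sets without interior points are nowhere dense (`IsPresharp.nowhereDenseOfDef`), hence that one of
countably many definable sets covering an open set has interior points, and from this that
frontiers have smaller dimension (`IsPresharp.dimLT_frontier`).
-/

namespace Presharp

open scoped Polynomial

/-! ### Tame families of predicates -/

/-- A family of predicates on `ℝ^n`, indexed by `I`, is tame with respect to `deg : I → ℕ` if the
sets that they cut out have a common format and a degree polynomial in `deg i`. For `I` a
one-point type this says that the predicate is definable. -/
def Tame (Ω : Family) {I : Type*} (deg : I → ℕ) {n : ℕ} (φ : I → (Fin n → ℝ) → Prop) : Prop :=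
  ∃ (F : ℕ) (P : ℕ[X]), ∀ i, {x | φ i x} ∈ Ω F (P.eval (deg i)) n

/-- A family of polynomial functions on `ℝ^n` of bounded degree. The coefficients may depend on
the index in any way. -/
def PolyFamily {I : Type*} {n : ℕ} (p : I → (Fin n → ℝ) → ℝ) : Prop :=
  ∃ d : ℕ, ∀ i, ∃ P : MvPolynomial (Fin n) ℝ, P.totalDegree ≤ d ∧
    ∀ x, p i x = MvPolynomial.eval x P

/-- The squared Euclidean distance. The type `Fin n → ℝ` carries the sup metric, whereas this
function is a polynomial. -/
def sqd {n : ℕ} (x y : Fin n → ℝ) : ℝ := ∑ j, (x j - y j) ^ 2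

section Poly

variable {I : Type*} {n : ℕ} {p q : I → (Fin n → ℝ) → ℝ}

theorem PolyFamily.const (c : I → ℝ) : PolyFamily (n := n) fun i _ => c i :=
  ⟨0, fun i => ⟨MvPolynomial.C (c i), by simp, by simp⟩⟩

theorem PolyFamily.coord (j : Fin n) : PolyFamily (I := I) fun _ x => x j :=
  ⟨1, fun _ => ⟨MvPolynomial.X j, by simp, by simp⟩⟩

theorem PolyFamily.add (hp : PolyFamily p) (hq : PolyFamily q) :
    PolyFamily fun i x => p i x + q i x := by
  obtain ⟨d, hd⟩ := hp
  obtain ⟨e, he⟩ := hq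
  refine ⟨max d e, fun i => ?_⟩
  obtain ⟨P, hP, hP'⟩ := hd i
  obtain ⟨Q, hQ, hQ'⟩ := he i
  exact ⟨P + Q, (MvPolynomial.totalDegree_add P Q).trans (max_le_max hP hQ),
    fun x => by simp [hP', hQ']⟩

theorem PolyFamily.mul (hp : PolyFamily p) (hq : PolyFamily q) :
    PolyFamily fun i x => p i x * q i x := by
  obtain ⟨d, hd⟩ := hp
  obtain ⟨e, he⟩ := hq
  refine ⟨d + e, fun i => ?_⟩
  obtain ⟨P, hP, hP'⟩ := hd i
  obtain ⟨Q, hQ, hQ'⟩ := he i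
  exact ⟨P * Q, (MvPolynomial.totalDegree_mul P Q).trans (add_le_add hP hQ),
    fun x => by simp [hP', hQ']⟩

theorem PolyFamily.sub (hp : PolyFamily p) (hq : PolyFamily q) :
    PolyFamily fun i x => p i x - q i x := by
  simpa [sub_eq_add_neg] using hp.add ((PolyFamily.const fun _ => -1).mul hq)

theorem PolyFamily.sum {m : ℕ} {p : Fin m → I → (Fin n → ℝ) → ℝ} (hp : ∀ j, PolyFamily (p j)) :
    PolyFamily fun i x => ∑ j, p j i x := by
  induction m with
  | zero => simpa using PolyFamily.const fun _ => 0
  | succ m ih => simpa [Fin.sum_univ_succ] using (hp 0).add (ih fun j => hp j.succ)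

theorem PolyFamily.sqd {m : ℕ} {p q : Fin m → I → (Fin n → ℝ) → ℝ}
    (hp : ∀ j, PolyFamily (p j)) (hq : ∀ j, PolyFamily (q j)) :
    PolyFamily fun i x => sqd (fun j => p j i x) (fun j => q j i x) := by
  simp only [Presharp.sqd, pow_two]
  exact PolyFamily.sum fun j => ((hp j).sub (hq j)).mul ((hp j).sub (hq j))

theorem PolyFamily.comp_castSucc {p : I → (Fin n → ℝ) → ℝ} (hp : PolyFamily p) :
    PolyFamily fun i (z : Fin (n + 1) → ℝ) => p i (fun j => z j.castSucc) := by
  obtain ⟨d, hd⟩ := hp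
  refine ⟨d, fun i => ?_⟩
  obtain ⟨P, hP, hP'⟩ := hd i
  refine ⟨MvPolynomial.rename Fin.castSucc P, (MvPolynomial.totalDegree_rename_le _ _).trans hP,
    fun x => ?_⟩
  rw [MvPolynomial.eval_rename]
  exact hP' _

theorem sqd_eq_zero {x y : Fin n → ℝ} : sqd x y = 0 ↔ x = y := by
  rw [sqd, Finset.sum_eq_zero_iff_of_nonneg fun _ _ => sq_nonneg _]
  simp [sub_eq_zero, funext_iff]

/-- The topologies given by the squared Euclidean distance and by the sup metric agree. -/
theorem hasBasis_nhds_sqd (x : Fin n → ℝ) :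
    (nhds x).HasBasis (fun δ : ℝ => 0 < δ) fun δ => {y | sqd x y < δ} := by
  refine Filter.hasBasis_iff.2 fun s => ⟨fun hs => ?_, fun ⟨δ, hδ, h⟩ => ?_⟩
  · obtain ⟨ε, hε, h⟩ := Metric.mem_nhds_iff.1 hs
    refine ⟨ε ^ 2, by positivity, fun y hy => h ?_⟩
    rw [Metric.mem_ball, dist_comm, dist_pi_lt_iff hε]
    intro j
    have h1 : (x j - y j) ^ 2 ≤ sqd x y :=
      Finset.single_le_sum (f := fun j => (x j - y j) ^ 2) (fun _ _ => sq_nonneg _)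
        (Finset.mem_univ j)
    exact abs_lt_of_sq_lt_sq (h1.trans_lt hy) hε.le
  · refine Filter.mem_of_superset (IsOpen.mem_nhds (isOpen_lt ?_ continuous_const) ?_) h
    · unfold sqd
      fun_prop
    · simpa [sqd] using hδ

end Poly

theorem IsFDFiltration.mem_of_le {L : FirstOrder.Language.{u, v}} [L.Structure ℝ] {Ω : Family}
    (h : IsFDFiltration L Ω) {F F' D D' n : ℕ} (hF : F ≤ F') (hD : D ≤ D')
    {A : Set (Fin n → ℝ)} (hA : A ∈ Ω F D n) : A ∈ Ω F' D' n := by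
  have h1 : A ∈ Ω F' D n := Nat.le_induction hA (fun k _ hk => (h.mono k D n hk).1) F' hF
  exact Nat.le_induction h1 (fun k _ hk => (h.mono F' k n hk).2) D' hD

namespace IsPresharp

variable {L : FirstOrder.Language.{u, v}} [L.Structure ℝ] {Ω : Family}
  {I : Type*} {deg : I → ℕ} {n : ℕ} {φ ψ : I → (Fin n → ℝ) → Prop}

theorem tame_not (hΩ : IsPresharp L Ω) (hφ : Tame Ω deg φ) : Tame Ω deg fun i x => ¬ φ i x := by
  obtain ⟨F, P, h⟩ := hφ
  exact ⟨F + 1, P, fun i => hΩ.compl_mem _ _ _ _ (h i)⟩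

theorem tame_and (hΩ : IsPresharp L Ω) (hφ : Tame Ω deg φ) (hψ : Tame Ω deg ψ) :
    Tame Ω deg fun i x => φ i x ∧ ψ i x := by
  obtain ⟨F, P, h⟩ := hφ
  obtain ⟨G, Q, h'⟩ := hψ
  refine ⟨max F G + 1, P + Q, fun i => ?_⟩
  rw [Polynomial.eval_add]
  exact hΩ.inter_mem _ _ _ _ _ _ (h i) _ (h' i)

theorem tame_or (hΩ : IsPresharp L Ω) (hφ : Tame Ω deg φ) (hψ : Tame Ω deg ψ) :
    Tame Ω deg fun i x => φ i x ∨ ψ i x := by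
  obtain ⟨F, P, h⟩ := hφ
  obtain ⟨G, Q, h'⟩ := hψ
  refine ⟨max F G + 1, P + Q, fun i => ?_⟩
  rw [Polynomial.eval_add]
  exact hΩ.union_mem _ _ _ _ _ _ (h i) _ (h' i)

theorem tame_imp (hΩ : IsPresharp L Ω) (hφ : Tame Ω deg φ) (hψ : Tame Ω deg ψ) :
    Tame Ω deg fun i x => φ i x → ψ i x := by
  simpa only [imp_iff_not_or] using hΩ.tame_or (hΩ.tame_not hφ) hψ

theorem tame_exists (hΩ : IsPresharp L Ω) {φ : I → (Fin n → ℝ) → ℝ → Prop}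
    (hφ : Tame Ω deg fun i (z : Fin (n + 1) → ℝ) =>
      φ i (fun j => z j.castSucc) (z (Fin.last n))) :
    Tame Ω deg fun i x => ∃ t, φ i x t := by
  obtain ⟨F, P, h⟩ := hφ
  refine ⟨F + 1, P, fun i => ?_⟩
  convert hΩ.proj_mem _ _ _ _ (h i)
  ext x
  constructor
  · rintro ⟨t, ht⟩
    exact ⟨Fin.snoc x t, by simpa using ht, by simp⟩
  · rintro ⟨z, hz, rfl⟩
    exact ⟨_, hz⟩

theorem tame_forall (hΩ : IsPresharp L Ω) {φ : I → (Fin n → ℝ) → ℝ → Prop}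
    (hφ : Tame Ω deg fun i (z : Fin (n + 1) → ℝ) =>
      φ i (fun j => z j.castSucc) (z (Fin.last n))) :
    Tame Ω deg fun i x => ∀ t, φ i x t := by
  have := hΩ.tame_not (hΩ.tame_exists (φ := fun i x t => ¬ φ i x t) (hΩ.tame_not hφ))
  simpa only [not_exists, not_not] using this

theorem tame_existsVec (hΩ : IsPresharp L Ω) {m : ℕ} {φ : I → (Fin n → ℝ) → (Fin m → ℝ) → Prop}
    (hφ : Tame Ω deg fun i (z : Fin (n + m) → ℝ) =>
      φ i (fun j => z (j.castAdd m)) (fun j => z (j.natAdd n))) :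
    Tame Ω deg fun i x => ∃ y, φ i x y := by
  induction m with
  | zero =>
    obtain ⟨F, P, h⟩ := hφ
    refine ⟨F, P, fun i => Eq.subst (Set.ext fun x => ?_) (h i)⟩
    exact ⟨fun h => ⟨_, h⟩, fun ⟨y, hy⟩ => (congrArg (φ i x) (Subsingleton.elim _ _)).mp hy⟩
  | succ m ih =>
    have key := ih (φ := fun i x y => ∃ t, φ i x (Fin.snoc y t)) (hΩ.tame_exists (by
      obtain ⟨F, P, h⟩ := hφ
      refine ⟨F, P, fun i => Eq.subst (Set.ext fun z => ?_) (h i)⟩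
      refine iff_of_eq (congrArg (φ i _) (funext fun j => ?_))
      refine Fin.lastCases ?_ (fun j => ?_) j
      · simp only [Fin.snoc_last]
        rfl
      · simp only [Fin.snoc_castSucc]
        rfl))
    convert key using 3 with i x
    constructor
    · rintro ⟨y, hy⟩
      exact ⟨Fin.init y, y (Fin.last m), by rwa [Fin.snoc_init_self]⟩
    · rintro ⟨y, t, h⟩
      exact ⟨_, h⟩

theorem tame_forallVec (hΩ : IsPresharp L Ω) {m : ℕ} {φ : I → (Fin n → ℝ) → (Fin m → ℝ) → Prop}
    (hφ : Tame Ω deg fun i (z : Fin (n + m) → ℝ) =>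
      φ i (fun j => z (j.castAdd m)) (fun j => z (j.natAdd n))) :
    Tame Ω deg fun i x => ∀ y, φ i x y := by
  have := hΩ.tame_not (hΩ.tame_existsVec (φ := fun i x t => ¬ φ i x t) (hΩ.tame_not hφ))
  simpa only [not_exists, not_not] using this

theorem tame_eq_zero (hΩ : IsPresharp L Ω) {p : I → (Fin n → ℝ) → ℝ} (hp : PolyFamily p) :
    Tame Ω deg fun i x => p i x = 0 := by
  obtain ⟨d, hd⟩ := hp
  refine ⟨n, Polynomial.C d, fun i => ?_⟩
  obtain ⟨P, hP, hP'⟩ := hd i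
  simp only [hP', Polynomial.eval_C]
  exact hΩ.filtration.mem_of_le le_rfl hP (hΩ.zeroSet_mem n P)

theorem tame_eq (hΩ : IsPresharp L Ω) {p q : I → (Fin n → ℝ) → ℝ} (hp : PolyFamily p)
    (hq : PolyFamily q) : Tame Ω deg fun i x => p i x = q i x := by
  simpa only [sub_eq_zero] using hΩ.tame_eq_zero (deg := deg) (hp.sub hq)

theorem tame_le (hΩ : IsPresharp L Ω) {p q : I → (Fin n → ℝ) → ℝ} (hp : PolyFamily p)
    (hq : PolyFamily q) : Tame Ω deg fun i x => p i x ≤ q i x := by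
  have := hΩ.tame_exists (deg := deg) (φ := fun i x t => p i x + t * t = q i x) (hΩ.tame_eq
    ((PolyFamily.comp_castSucc hp).add ((PolyFamily.coord _).mul (PolyFamily.coord _)))
    (PolyFamily.comp_castSucc hq))
  convert this using 3 with i x
  constructor
  · intro h
    exact ⟨√(q i x - p i x), by rw [Real.mul_self_sqrt (sub_nonneg.2 h)]; ring⟩
  · rintro ⟨t, ht⟩
    nlinarith [mul_self_nonneg t]

theorem tame_lt (hΩ : IsPresharp L Ω) {p q : I → (Fin n → ℝ) → ℝ} (hp : PolyFamily p)
    (hq : PolyFamily q) : Tame Ω deg fun i x => p i x < q i x := by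
  simpa only [not_le] using hΩ.tame_not (hΩ.tame_le (deg := deg) hq hp)

theorem tame_forallFin (hΩ : IsPresharp L Ω) {m : ℕ} {φ : Fin m → I → (Fin n → ℝ) → Prop}
    (hφ : ∀ j, Tame Ω deg (φ j)) : Tame Ω deg fun i x => ∀ j, φ j i x := by
  induction m with
  | zero =>
    simpa using hΩ.tame_eq_zero (n := n) (deg := deg) (PolyFamily.const fun _ => 0)
  | succ m ih =>
    simpa only [Fin.forall_fin_succ] using hΩ.tame_and (hφ 0) (ih fun j => hφ j.succ)

/-- Iterated products `ℝ^m × A`; the equation for `k` avoids casts between `Fin` types. -/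
theorem tame_Rprod_iterate (hΩ : IsPresharp L Ω) (hφ : Tame Ω deg φ) (m : ℕ) :
    ∀ (k : ℕ) (τ : Fin n → Fin k), k = n + m → (∀ j, (τ j : ℕ) = m + j) →
      Tame Ω deg fun i (z : Fin k → ℝ) => φ i (fun j => z (τ j)) := by
  induction m with
  | zero =>
    rintro k τ rfl hτ
    obtain rfl : τ = id := funext fun j => Fin.ext (by simp [hτ])
    exact hφ
  | succ m ih =>
    rintro k τ rfl hτ
    obtain ⟨F, P, h⟩ := ih (n + m) (fun j => ⟨m + j, by omega⟩) rfl (fun _ => rfl)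
    refine ⟨F + 1, P, fun i => ?_⟩
    have : τ = fun j : Fin n => Fin.succ (n := n + m) ⟨m + j, by omega⟩ :=
      funext fun j => Fin.ext ((hτ j).trans (Nat.add_right_comm m 1 j))
    rw [this]
    exact hΩ.Rprod_mem _ _ _ _ (h i)

/-- Tameness is stable under permuting, repeating and adding variables. -/
theorem tame_comp (hΩ : IsPresharp L Ω) {m : ℕ} (hφ : Tame Ω deg φ) (σ : Fin n → Fin m) :
    Tame Ω deg fun i (z : Fin m → ℝ) => φ i (fun j => z (σ j)) := by
  have key := hΩ.tame_existsVec (n := m) (deg := deg)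
    (φ := fun i x y => φ i y ∧ sqd y (fun j => x (σ j)) = 0)
    (hΩ.tame_and (hΩ.tame_Rprod_iterate hφ m _ (Fin.natAdd m) (Nat.add_comm _ _) (fun j => rfl))
      (hΩ.tame_eq_zero (PolyFamily.sqd (fun j => .coord _) (fun j => .coord _))))
  simpa only [sqd_eq_zero, exists_eq_right] using key

/-- Substitution of variables in the membership predicate of a tame family of sets. -/
theorem tame_mem (hΩ : IsPresharp L Ω) {m : ℕ} {A : I → Set (Fin n → ℝ)}
    (hA : Tame Ω deg fun i x => x ∈ A i) (σ : Fin n → Fin m) :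
    Tame Ω deg fun i (z : Fin m → ℝ) => (fun j => z (σ j)) ∈ A i :=
  hΩ.tame_comp hA σ

theorem tame_closure (hΩ : IsPresharp L Ω) {A : I → Set (Fin n → ℝ)}
    (hA : Tame Ω deg fun i x => x ∈ A i) : Tame Ω deg fun i x => x ∈ closure (A i) := by
  have key : Tame Ω deg fun i x => ∀ δ : ℝ, 0 < δ → ∃ y, y ∈ A i ∧ sqd x y < δ :=
    hΩ.tame_forall (hΩ.tame_imp (hΩ.tame_lt (.const _) (.coord _))
      (hΩ.tame_existsVec (hΩ.tame_and (hΩ.tame_mem hA _)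
        (hΩ.tame_lt (PolyFamily.sqd (fun j => .coord _) (fun j => .coord _)) (.coord _)))))
  convert key using 3 with i x
  rw [mem_closure_iff_nhds_basis (hasBasis_nhds_sqd x)]
  rfl

/-- Images under coordinate projections. -/
theorem tame_image (hΩ : IsPresharp L Ω) {d : ℕ} {A : I → Set (Fin n → ℝ)}
    (hA : Tame Ω deg fun i x => x ∈ A i) (e : Fin d → Fin n) :
    Tame Ω deg fun i y => y ∈ (fun (x : Fin n → ℝ) j => x (e j)) '' A i := by
  have key : Tame Ω deg fun i y => ∃ x, x ∈ A i ∧ ∀ j, x (e j) = y j :=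
    hΩ.tame_existsVec (hΩ.tame_and (hΩ.tame_mem hA _)
      (hΩ.tame_forallFin fun j => hΩ.tame_eq (.coord _) (.coord _)))
  simpa only [Set.mem_image, _root_.funext_iff] using key

end IsPresharp

/-! ### Baire category for definable sets -/

/-- Definability, expressed as tameness of a one-member family. -/
abbrev DefSet (Ω : Family) {n : ℕ} (A : Set (Fin n → ℝ)) : Prop :=
  Tame Ω (fun _ : Unit => 0) fun _ x => x ∈ A

theorem Tame.defSet {Ω : Family} {I : Type*} {deg : I → ℕ} {n : ℕ} {φ : I → (Fin n → ℝ) → Prop}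
    (h : Tame Ω deg φ) (i : I) : DefSet Ω {x | φ i x} := by
  obtain ⟨F, P, h⟩ := h
  exact ⟨F, Polynomial.C (P.eval (deg i)), fun _ => by simpa using h i⟩

theorem isOpen_cylinder {n : ℕ} {V : Set (Fin n → ℝ)} (hV : IsOpen V) (a b : ℝ) :
    IsOpen {z : Fin (n + 1) → ℝ | (fun j => z j.castSucc) ∈ V ∧ a < z (Fin.last n) ∧
      z (Fin.last n) < b} := by
  exact (hV.preimage (by fun_prop)).and
    ((isOpen_lt (by fun_prop) (by fun_prop)).and (isOpen_lt (by fun_prop) (by fun_prop)))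

theorem cylinder_nonempty {n : ℕ} {V : Set (Fin n → ℝ)} (hV : V.Nonempty) {a b : ℝ} (h : a < b) :
    {z : Fin (n + 1) → ℝ | (fun j => z j.castSucc) ∈ V ∧ a < z (Fin.last n) ∧
      z (Fin.last n) < b}.Nonempty := by
  obtain ⟨y, hy⟩ := hV
  obtain ⟨t, ht⟩ := exists_between h
  exact ⟨Fin.snoc y t, by simpa using hy, by simpa using ht⟩

theorem exists_rat_Ioo_subset {U : Set ℝ} (hU : IsOpen U) (hne : U.Nonempty) :
    ∃ a b : ℚ, a < b ∧ Set.Ioo (a : ℝ) b ⊆ U := by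
  obtain ⟨t, ht⟩ := hne
  obtain ⟨ε, hε, h⟩ := Metric.isOpen_iff.1 hU t ht
  rw [Real.ball_eq_Ioo] at h
  obtain ⟨a, ha, ha'⟩ := exists_rat_btwn (show t - ε < t by linarith)
  obtain ⟨b, hb, hb'⟩ := exists_rat_btwn (show t < t + ε by linarith)
  exact ⟨a, b, by exact_mod_cast ha'.trans hb, fun s hs => h ⟨ha.trans hs.1, hs.2.trans hb'⟩⟩

namespace IsPresharp

variable {L : FirstOrder.Language.{u, v}} [L.Structure ℝ] {Ω : Family} {n : ℕ}

/-- O-minimality: an infinite definable subset of the line contains an interval. -/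
theorem exists_Ioo_subset (hΩ : IsPresharp L Ω) {A : Set ℝ}
    (hA : DefSet Ω {x : Fin 1 → ℝ | x 0 ∈ A}) (hinf : A.Infinite) :
    ∃ a b : ℚ, a < b ∧ Set.Ioo (a : ℝ) b ⊆ A := by
  obtain ⟨F, P, h⟩ := hA
  obtain ⟨T, hT, hJ, rfl⟩ := hΩ.oMinimal.finite_union A (hΩ.filtration.definable _ _ _ _ (h ()))
  obtain ⟨J, hJT, hJinf⟩ : ∃ J ∈ T, J.Infinite := by
    by_contra! hcon
    exact hinf (hT.sUnion fun J hJ' => hcon J hJ')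
  rcases hJ J hJT with ⟨a, rfl⟩ | ⟨a, b, rfl⟩
  · exact absurd (Set.finite_singleton a) hJinf
  · obtain ⟨x, hx, y, hy, hxy⟩ := hJinf.nontrivial.exists_lt
    obtain ⟨p, q, hpq, hsub⟩ := exists_rat_Ioo_subset isOpen_Ioo (Set.nonempty_Ioo.2 hxy)
    refine ⟨p, q, hpq, fun t ht => ⟨_, hJT, ?_⟩⟩
    exact ⟨hx.1.trans (EReal.coe_lt_coe_iff.2 (hsub ht).1),
      (EReal.coe_lt_coe_iff.2 (hsub ht).2).trans hy.2⟩

theorem defSet_ball (hΩ : IsPresharp L Ω) (c : Fin n → ℝ) {r : ℝ} (hr : 0 < r) :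
    DefSet Ω (Metric.ball c r) := by
  have key : Tame Ω (fun _ : Unit => 0) fun _ (x : Fin n → ℝ) =>
      ∀ j, c j - r < x j ∧ x j < c j + r :=
    hΩ.tame_forallFin fun j => hΩ.tame_and (hΩ.tame_lt (.const _) (.coord _))
      (hΩ.tame_lt (.coord _) (.const _))
  convert key using 3 with i x
  rw [ball_pi c hr]
  simp [Real.ball_eq_Ioo]

theorem defSet_snoc (A : Set (Fin (n + 1) → ℝ)) (hA : DefSet Ω A) :
    DefSet Ω {z : Fin (n + 1) → ℝ |
      (Fin.snoc (α := fun _ => ℝ) (fun j => z j.castSucc) (z (Fin.last n)) : Fin (n + 1) → ℝ) ∈ A} := by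
  convert hA using 3 with _
  ext z
  exact iff_of_eq (congrArg (· ∈ A) (Fin.snoc_init_self z))

/-- Definable sets without interior points are nowhere dense in `ℝ^n`. -/
def NowhereDenseOfDef (Ω : Family) (n : ℕ) : Prop :=
  ∀ A : Set (Fin n → ℝ), DefSet Ω A → interior A = ∅ → IsNowhereDense A

/-- By Baire's theorem, of countably many definable sets that cover a nonempty open set, one has
interior points. -/
theorem NowhereDenseOfDef.exists_interior_nonempty (h : NowhereDenseOfDef Ω n)
    {ι : Type*} [Countable ι] {S : ι → Set (Fin n → ℝ)} (hS : ∀ k, DefSet Ω (S k))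
    {U : Set (Fin n → ℝ)} (hU : IsOpen U) (hne : U.Nonempty) (hcov : U ⊆ ⋃ k, S k) :
    ∃ k, (interior (S k)).Nonempty := by
  by_contra! hcon
  exact not_isMeagre_of_isOpen hU hne
    ((isMeagre_iUnion fun k => (h _ (hS k) (hcon k)).isMeagre).mono hcov)

theorem defSet_fibre (hΩ : IsPresharp L Ω) {A : Set (Fin (n + 1) → ℝ)} (hA : DefSet Ω A)
    (y : Fin n → ℝ) : DefSet Ω {x : Fin 1 → ℝ | Fin.snoc (α := fun _ => ℝ) y (x 0) ∈ A} := by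
  have key : Tame Ω (fun _ : Unit => 0) fun _ (x : Fin 1 → ℝ) =>
      ∃ z : Fin (n + 1) → ℝ, z ∈ A ∧ (∀ j : Fin n, z j.castSucc = y j) ∧ z (Fin.last n) = x 0 :=
    hΩ.tame_existsVec (hΩ.tame_and (hΩ.tame_mem hA _) (hΩ.tame_and
      (hΩ.tame_forallFin fun j => hΩ.tame_eq (.coord _) (.const _))
      (hΩ.tame_eq (.coord _) (.coord _))))
  convert key using 3 with i x
  constructor
  · exact fun h => ⟨_, h, by simp, by simp⟩
  · rintro ⟨z, hz, h1, h2⟩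
    rw [Set.mem_ofPred_eq, ← h2, ← funext h1]
    exact (Fin.snoc_init_self z).symm ▸ hz

/-- The induction step applies Baire's theorem in `ℝ^n` to the fibres `A_y`. Let `A` be dense in the
product of a ball `U` and an interval `J`. Over `y ∈ U`, either `A_y` misses a rational interval
that meets `J`, or `A_y` is infinite and hence contains a rational interval. For a fixed interval,
the set of `y` of the first kind has no interior points, as `A` is dense. So for some interval the set
of `y` of the second kind has interior points, and then so has `A`. -/
theorem nowhereDenseOfDef (hΩ : IsPresharp L Ω) (n : ℕ) : NowhereDenseOfDef Ω n := by
  induction n with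
  | zero =>
    intro A _ hA
    rw [(isOpen_discrete A).interior_eq] at hA
    simp [IsNowhereDense, hA]
  | succ n ih =>
    intro A hA hint
    by_contra hcon
    obtain ⟨w, hw⟩ := Set.nonempty_iff_ne_empty.2 hcon
    obtain ⟨ε, hε, hball⟩ := Metric.isOpen_iff.1 isOpen_interior w hw
    have hdense : ∀ V ⊆ Metric.ball w ε, IsOpen V → V.Nonempty → (V ∩ A).Nonempty := by
      rintro V hVs hV ⟨z, hz⟩
      exact mem_closure_iff.1 (interior_subset (hball (hVs hz))) V hV hz
    set U : Set (Fin n → ℝ) := Metric.ball (fun j => w j.castSucc) ε with hU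
    set c : ℝ := w (Fin.last n) with hc
    have hmem : ∀ z : Fin (n + 1) → ℝ, (fun j => z j.castSucc) ∈ U → c - ε < z (Fin.last n) →
        z (Fin.last n) < c + ε → z ∈ Metric.ball w ε := by
      intro z hz h1 h2
      rw [hU, Metric.mem_ball, dist_pi_lt_iff hε] at hz
      rw [Metric.mem_ball, dist_pi_lt_iff hε]
      refine Fin.lastCases ?_ hz
      rw [Real.dist_eq, abs_lt]
      constructor <;> linarith
    let N : ℚ × ℚ → Set (Fin n → ℝ) := fun q => {y | y ∈ U ∧
      (max (c - ε) q.1 < min (c + ε) q.2 ∧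
        ¬ ∃ t : ℝ, (q.1 < t ∧ t < q.2) ∧ Fin.snoc (α := fun _ => ℝ) y t ∈ A)}
    let E : ℚ × ℚ → Set (Fin n → ℝ) := fun q => {y | (q.1 : ℝ) < q.2 ∧
      ∀ t : ℝ, (q.1 < t ∧ t < q.2) → Fin.snoc (α := fun _ => ℝ) y t ∈ A}
    have hN : ∀ q, DefSet Ω (N q) := fun q =>
      hΩ.tame_and (hΩ.defSet_ball _ hε) (hΩ.tame_and (hΩ.tame_lt (.const _) (.const _))
        (hΩ.tame_not (hΩ.tame_exists (hΩ.tame_and (hΩ.tame_and (hΩ.tame_lt (.const _) (.coord _))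
          (hΩ.tame_lt (.coord _) (.const _))) (defSet_snoc A hA)))))
    have hE : ∀ q, DefSet Ω (E q) := fun q =>
      hΩ.tame_and (hΩ.tame_lt (.const _) (.const _))
        (hΩ.tame_forall (hΩ.tame_imp (hΩ.tame_and (hΩ.tame_lt (.const _) (.coord _))
          (hΩ.tame_lt (.coord _) (.const _))) (defSet_snoc A hA)))
    have hNint : ∀ q, ¬ (interior (N q)).Nonempty := by
      intro q hne
      obtain ⟨y, hy⟩ := hne
      have hq := (interior_subset hy).2.1
      obtain ⟨z, ⟨hz1, hz2, hz3⟩, hzA⟩ := hdense {z | _ ∧ _ ∧ _}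
        (fun z ⟨hz1, hz2, hz3⟩ => hmem z (interior_subset hz1).1
          ((le_max_left _ _).trans_lt hz2) (hz3.trans_le (min_le_left _ _)))
        (isOpen_cylinder isOpen_interior _ _) (cylinder_nonempty ⟨y, hy⟩ hq)
      refine (interior_subset hz1).2.2 ⟨z (Fin.last n),
        ⟨(le_max_right _ _).trans_lt hz2, hz3.trans_le (min_le_right _ _)⟩, ?_⟩
      exact (Fin.snoc_init_self z).symm ▸ hzA
    have hEint : ∀ q, ¬ (interior (E q)).Nonempty := by
      intro q hne
      obtain ⟨y, hy⟩ := hne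
      have hq := (interior_subset hy).1
      obtain ⟨z, hz⟩ := cylinder_nonempty ⟨y, hy⟩ hq
      refine (Set.eq_empty_iff_forall_notMem.1 hint) z
        (mem_interior.2 ⟨_, ?_, isOpen_cylinder isOpen_interior _ _, hz⟩)
      rintro z ⟨hz1, hz2⟩
      exact (Fin.snoc_init_self z) ▸ (interior_subset hz1).2 _ hz2
    have hcov : U ⊆ ⋃ k : (ℚ × ℚ) ⊕ (ℚ × ℚ), Sum.elim N E k := by
      intro y hy
      rw [Set.mem_iUnion, Sum.exists]
      by_cases hfin : {t : ℝ | Fin.snoc (α := fun _ => ℝ) y t ∈ A}.Finite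
      · left
        obtain ⟨a, b, hab, hsub⟩ := exists_rat_Ioo_subset
          ((isOpen_Ioo (a := c - ε) (b := c + ε)).inter hfin.isClosed.isOpen_compl)
          ((Set.Ioo_infinite (show c - ε < c + ε by linarith)).sdiff hfin).nonempty
        have hab' : (a : ℝ) < b := by exact_mod_cast hab
        refine ⟨(a, b), hy, ?_, ?_⟩
        · obtain ⟨t, ht⟩ := exists_between hab'
          exact (max_lt (hsub ht).1.1 ht.1).trans (lt_min (hsub ht).1.2 ht.2)
        · rintro ⟨t, ht, htA⟩
          exact (hsub ht).2 htA
      · right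
        obtain ⟨a, b, hab, hsub⟩ := hΩ.exists_Ioo_subset (hΩ.defSet_fibre hA y) hfin
        exact ⟨(a, b), by exact_mod_cast hab, fun t ht => hsub ht⟩
    obtain ⟨k | k, hk⟩ := ih.exists_interior_nonempty (fun k => Sum.rec hN hE k)
      Metric.isOpen_ball ⟨_, Metric.mem_ball_self hε⟩ hcov
    · exact hNint k hk
    · exact hEint k hk

end IsPresharp

/-! ### Dimension and frontiers -/

/-- The set `X ⊆ ℝ^n` has dimension less than `d`: no projection of `X` to `d` coordinates has
interior points. A coordinate may be repeated, which makes no difference. -/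
def DimLT {n : ℕ} (d : ℕ) (X : Set (Fin n → ℝ)) : Prop :=
  ∀ e : Fin d → Fin n, interior ((fun (x : Fin n → ℝ) j => x (e j)) '' X) = ∅

/-- The points of `X` at which `X` is not locally closed. -/
def badPart {n : ℕ} (X : Set (Fin n → ℝ)) : Set (Fin n → ℝ) :=
  X ∩ closure (closure X \ X)

section Dim

variable {n d : ℕ} {X Y : Set (Fin n → ℝ)}

theorem DimLT.mono (h : DimLT d X) (hYX : Y ⊆ X) : DimLT d Y := fun e =>
  Set.subset_eq_empty (interior_mono (Set.image_mono hYX)) (h e)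

theorem DimLT.succ (h : DimLT d X) : DimLT (d + 1) X := by
  intro e
  rw [Set.eq_empty_iff_forall_notMem]
  intro w hw
  let V : Set (Fin d → ℝ) := {y | (Fin.snoc (α := fun _ => ℝ) y (w (Fin.last d)) : Fin (d + 1) → ℝ)
    ∈ interior ((fun (x : Fin n → ℝ) j => x (e j)) '' X)}
  have hV : IsOpen V := isOpen_interior.preimage (by fun_prop)
  refine (Set.eq_empty_iff_forall_notMem.1 (h fun j => e j.castSucc)) (Fin.init w)
    (mem_interior.2 ⟨V, ?_, hV, ?_⟩)
  · intro y hy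
    obtain ⟨x, hx, hxy⟩ := interior_subset hy
    refine ⟨x, hx, funext fun j => ?_⟩
    simpa using congrFun hxy j.castSucc
  · simpa [V] using hw

theorem DimLT.eq_empty (h : DimLT 0 X) : X = ∅ := by
  have := h Fin.elim0
  rwa [(isOpen_discrete _).interior_eq, Set.image_eq_empty] at this

theorem dimLT_of_lt (hd : n < d) : DimLT d X := by
  intro e
  obtain ⟨a, b, hab, hne⟩ : ∃ a b, e a = e b ∧ a ≠ b := by
    by_contra! hcon
    have := Fintype.card_le_of_injective e fun a b hab => hcon a b hab
    simp at this
    omega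
  by_contra hcon
  let K : Submodule ℝ (Fin d → ℝ) :=
    LinearMap.eqLocus (LinearMap.proj (R := ℝ) (φ := fun _ => ℝ) a) (LinearMap.proj b)
  have hK : (interior (K : Set (Fin d → ℝ))).Nonempty := by
    refine (Set.nonempty_iff_ne_empty.2 hcon).mono (interior_mono ?_)
    rintro _ ⟨x, -, rfl⟩
    exact congrArg x hab
  have h1 : (Pi.single a 1 : Fin d → ℝ) ∈ K := by
    rw [K.eq_top_of_nonempty_interior' hK]
    trivial
  have h2 : (Pi.single a 1 : Fin d → ℝ) a = (Pi.single a 1 : Fin d → ℝ) b := h1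
  simp [hne.symm] at h2

end Dim

/-- The balls of a countable basis of the topology of `ℝ^n`. -/
def basicBall (n : ℕ) (q : ℕ × ℕ) : Set (Fin n → ℝ) :=
  Metric.ball (TopologicalSpace.denseSeq (Fin n → ℝ) q.1) (1 / (q.2 + 1))

theorem exists_basicBall {n : ℕ} {x : Fin n → ℝ} {O : Set (Fin n → ℝ)} (hO : IsOpen O)
    (hx : x ∈ O) : ∃ q, x ∈ basicBall n q ∧ basicBall n q ⊆ O := by
  obtain ⟨ε, hε, h⟩ := Metric.isOpen_iff.1 hO x hx
  obtain ⟨m, hm⟩ := exists_nat_one_div_lt (half_pos hε)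
  obtain ⟨_, hk, ⟨k, rfl⟩⟩ := Metric.dense_iff.1
    (TopologicalSpace.denseRange_denseSeq (Fin n → ℝ)) x (1 / (m + 1)) Nat.one_div_pos_of_nat
  refine ⟨(k, m), Metric.mem_ball_comm.1 hk, fun y hy => h ?_⟩
  have h1 := Metric.mem_ball.1 hk
  have h2 := Metric.mem_ball.1 hy
  have h3 := dist_triangle y (TopologicalSpace.denseSeq (Fin n → ℝ) k) x
  rw [Metric.mem_ball]
  simp only at h2
  linarith

namespace IsPresharp

variable {L : FirstOrder.Language.{u, v}} [L.Structure ℝ] {Ω : Family} {n d : ℕ}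

theorem tame_badPart (hΩ : IsPresharp L Ω) {I : Type*} {deg : I → ℕ} {X : I → Set (Fin n → ℝ)}
    (hX : Tame Ω deg fun i x => x ∈ X i) : Tame Ω deg fun i x => x ∈ badPart (X i) :=
  hΩ.tame_and hX (hΩ.tame_closure (A := fun i => closure (X i) \ X i)
    (hΩ.tame_and (hΩ.tame_closure hX) (hΩ.tame_not hX)))

theorem tame_badPart_iterate (hΩ : IsPresharp L Ω) {I : Type*} {deg : I → ℕ}
    {X : I → Set (Fin n → ℝ)} (hX : Tame Ω deg fun i x => x ∈ X i) (k : ℕ) :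
    Tame Ω deg fun i x => x ∈ badPart^[k] (X i) := by
  induction k with
  | zero => exact hX
  | succ k ih =>
    simp only [Function.iterate_succ_apply']
    exact hΩ.tame_badPart ih

theorem dimLT_union (hΩ : IsPresharp L Ω) {X Y : Set (Fin n → ℝ)} (hX : DefSet Ω X)
    (hY : DefSet Ω Y) (h : DimLT d X) (h' : DimLT d Y) : DimLT d (X ∪ Y) := by
  intro e
  by_contra hcon
  obtain ⟨k, hk⟩ := (hΩ.nowhereDenseOfDef d).exists_interior_nonempty
    (S := fun k : Bool => (fun (x : Fin n → ℝ) j => x (e j)) '' (bif k then X else Y))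
    (fun k => hΩ.tame_image (by cases k; exacts [hY, hX]) e) isOpen_interior
    (Set.nonempty_iff_ne_empty.2 hcon) (interior_subset.trans (by
      rw [Set.image_union]
      exact Set.union_subset (Set.subset_iUnion_of_subset true subset_rfl)
        (Set.subset_iUnion_of_subset false subset_rfl)))
  cases k
  · exact hk.ne_empty (h' e)
  · exact hk.ne_empty (h e)

/-- The frontier of a definable set has smaller dimension. Suppose that the projection to `ℝ^d`
of the frontier of a set `X` of dimension at most `d` contains an open set. Over a point `y` of
this open set, either the fibre of `X` is infinite and some coordinate takes on it all values in a
rational interval, or the fibre is finite and some basic ball meets the fibre of the frontier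
but not that of `X`. By Baire's theorem, one of these countably many alternatives occurs for all `y`
in an open set. The first contradicts the bound on the dimension, the second the fact that the
frontier consists of limits of points of `X`. -/
theorem dimLT_frontier (hΩ : IsPresharp L Ω) {X : Set (Fin n → ℝ)} (hX : DefSet Ω X)
    (h : DimLT (d + 1) X) : DimLT d (closure X \ X) := by
  intro e
  by_contra hcon
  let N : Fin n × ℚ × ℚ → Set (Fin d → ℝ) := fun q => {y | (q.2.1 : ℝ) < q.2.2 ∧
    ∀ t : ℝ, (q.2.1 < t ∧ t < q.2.2) → ∃ x, x ∈ X ∧ (∀ i, x (e i) = y i) ∧ x q.1 = t}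
  let E : ℕ × ℕ → Set (Fin d → ℝ) := fun q => {y |
    (∃ x, ((x ∈ closure X ∧ x ∉ X) ∧ x ∈ basicBall n q) ∧ ∀ i, x (e i) = y i) ∧
      ¬ ∃ x, (x ∈ X ∧ x ∈ basicBall n q) ∧ ∀ i, x (e i) = y i}
  have hB : ∀ q, DefSet Ω (basicBall n q) := fun q => hΩ.defSet_ball _ Nat.one_div_pos_of_nat
  have hcl : DefSet Ω (closure X) := hΩ.tame_closure hX
  have hN : ∀ q, DefSet Ω (N q) := fun q =>
    hΩ.tame_and (hΩ.tame_lt (.const _) (.const _)) (hΩ.tame_forall (hΩ.tame_imp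
      (hΩ.tame_and (hΩ.tame_lt (.const _) (.coord _)) (hΩ.tame_lt (.coord _) (.const _)))
      (hΩ.tame_existsVec (hΩ.tame_and (hΩ.tame_mem hX _) (hΩ.tame_and
        (hΩ.tame_forallFin fun j => hΩ.tame_eq (.coord _) (.coord _))
        (hΩ.tame_eq (.coord _) (.coord _)))))))
  have hE : ∀ q, DefSet Ω (E q) := fun q =>
    hΩ.tame_and
      (hΩ.tame_existsVec (hΩ.tame_and (hΩ.tame_and (hΩ.tame_and (hΩ.tame_mem hcl _)
        (hΩ.tame_not (hΩ.tame_mem hX _))) (hΩ.tame_mem (hB q) _))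
        (hΩ.tame_forallFin fun j => hΩ.tame_eq (.coord _) (.coord _))))
      (hΩ.tame_not (hΩ.tame_existsVec (hΩ.tame_and (hΩ.tame_and (hΩ.tame_mem hX _)
        (hΩ.tame_mem (hB q) _))
        (hΩ.tame_forallFin fun j => hΩ.tame_eq (.coord _) (.coord _)))))
  have hNint : ∀ q, ¬ (interior (N q)).Nonempty := by
    rintro q ⟨y, hy⟩
    obtain ⟨z, hz⟩ := cylinder_nonempty ⟨y, hy⟩ (interior_subset hy).1
    refine (Set.eq_empty_iff_forall_notMem.1 (h (Fin.snoc (α := fun _ => Fin n) e q.1))) z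
      (mem_interior.2 ⟨_, ?_, isOpen_cylinder isOpen_interior _ _, hz⟩)
    rintro z ⟨hz1, hz2⟩
    obtain ⟨x, hx, hx1, hx2⟩ := (interior_subset hz1).2 _ hz2
    refine ⟨x, hx, funext fun j => ?_⟩
    refine Fin.lastCases ?_ (fun j => ?_) j
    · simpa using hx2
    · simpa using hx1 j
  have hEint : ∀ q, ¬ (interior (E q)).Nonempty := by
    rintro q ⟨y, hy⟩
    obtain ⟨x, ⟨⟨hx1, hx2⟩, hxq⟩, hxy⟩ := (interior_subset hy).1
    obtain ⟨x', ⟨hx'1, hx'2⟩, hx'X⟩ := mem_closure_iff.1 hx1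
      (basicBall n q ∩ (fun (x : Fin n → ℝ) j => x (e j)) ⁻¹' interior (E q))
      (Metric.isOpen_ball.inter (isOpen_interior.preimage (by fun_prop)))
      ⟨hxq, by rwa [Set.mem_preimage, funext hxy]⟩
    exact (interior_subset hx'2).2 ⟨x', ⟨hx'X, hx'1⟩, fun _ => rfl⟩
  have hcov : interior ((fun (x : Fin n → ℝ) j => x (e j)) '' (closure X \ X)) ⊆
      ⋃ k : (Fin n × ℚ × ℚ) ⊕ (ℕ × ℕ), Sum.elim N E k := by
    intro y hy
    obtain ⟨x, ⟨hx1, hx2⟩, rfl⟩ := interior_subset hy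
    rw [Set.mem_iUnion, Sum.exists]
    set S : Set (Fin n → ℝ) := {x' | x' ∈ X ∧ ∀ i, x' (e i) = x (e i)} with hS
    by_cases hfin : S.Finite
    · right
      obtain ⟨q, hq1, hq2⟩ := exists_basicBall hfin.isClosed.isOpen_compl
        (show x ∈ Sᶜ from fun hxS => hx2 hxS.1)
      exact ⟨q, ⟨x, ⟨⟨hx1, hx2⟩, hq1⟩, fun _ => rfl⟩,
        fun ⟨x', ⟨h1, h2⟩, h3⟩ => hq2 h2 ⟨h1, h3⟩⟩
    · left
      obtain ⟨j, hj⟩ : ∃ j, ((fun x' : Fin n → ℝ => x' j) '' S).Infinite := by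
        by_contra! hcon
        refine hfin ((Set.Finite.pi fun j => hcon j).subset ?_)
        exact fun x' hx' j _ => ⟨x', hx', rfl⟩
      have hdef : DefSet Ω {s : Fin 1 → ℝ | s 0 ∈ (fun x' : Fin n → ℝ => x' j) '' S} :=
        hΩ.tame_existsVec (hΩ.tame_and (hΩ.tame_and (hΩ.tame_mem hX _)
          (hΩ.tame_forallFin fun j => hΩ.tame_eq (.coord _) (.const _)))
          (hΩ.tame_eq (.coord _) (.coord _)))
      obtain ⟨a, b, hab, hsub⟩ := hΩ.exists_Ioo_subset hdef hj
      refine ⟨(j, a, b), by exact_mod_cast hab, fun t ht => ?_⟩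
      obtain ⟨x', ⟨h1, h2⟩, h3⟩ := hsub ht
      exact ⟨x', h1, h2, h3⟩
  obtain ⟨k | k, hk⟩ := (hΩ.nowhereDenseOfDef d).exists_interior_nonempty
    (fun k => Sum.rec hN hE k) isOpen_interior (Set.nonempty_iff_ne_empty.2 hcon) hcov
  · exact hNint k hk
  · exact hEint k hk

/-- The bad part lies in the closure of the frontier, that is, in the union of the frontier and the
frontier of the frontier. -/
theorem dimLT_badPart (hΩ : IsPresharp L Ω) {X : Set (Fin n → ℝ)} (hX : DefSet Ω X)
    (h : DimLT (d + 1) X) : DimLT d (badPart X) := by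
  have hfr : DefSet Ω (closure X \ X) := hΩ.tame_and (hΩ.tame_closure hX) (hΩ.tame_not hX)
  have h1 := hΩ.dimLT_frontier hX h
  have hfr' : DefSet Ω (closure (closure X \ X) \ (closure X \ X)) :=
    hΩ.tame_and (hΩ.tame_closure hfr) (hΩ.tame_not hfr)
  have h2 := hΩ.dimLT_union hfr hfr' h1 (hΩ.dimLT_frontier hfr h1.succ)
  refine h2.mono fun x hx => ?_
  by_cases hx' : x ∈ closure X \ X
  · exact Or.inl hx'
  · exact Or.inr ⟨hx.2, hx'⟩

theorem badPart_iterate_eq_empty (hΩ : IsPresharp L Ω) {X : Set (Fin n → ℝ)} (hX : DefSet Ω X) :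
    badPart^[n + 1] X = ∅ := by
  have key : ∀ d (X : Set (Fin n → ℝ)), DefSet Ω X → DimLT d X → badPart^[d] X = ∅ := by
    intro d
    induction d with
    | zero => exact fun X _ h => h.eq_empty
    | succ d ih => exact fun X hX h => ih _ (hΩ.tame_badPart hX) (hΩ.dimLT_badPart hX h)
  exact key _ X hX (dimLT_of_lt n.lt_succ_self)

end IsPresharp

/-! ### Counting pieces with locally constant functions -/

/-- A locally constant function on `X` takes at most `N` values. The functions are taken on the whole
space, with conditions on `X` only, so that they restrict to subsets of `X` without coercions. -/
def PiecesLE {n : ℕ} (X : Set (Fin n → ℝ)) (N : ℝ) : Prop :=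
  ∀ g : (Fin n → ℝ) → ℕ, ContinuousOn g X → ∀ T : Finset ℕ, (T : Set ℕ) ⊆ g '' X →
    (T.card : ℝ) ≤ N

/-- The local minima on `Y` of the squared distance to `p`. -/
def localMinima {n : ℕ} (p : Fin n → ℝ) (Y : Set (Fin n → ℝ)) : Set (Fin n → ℝ) :=
  {x | x ∈ Y ∧ ∃ δ : ℝ, 0 < δ ∧ ∀ y, y ∈ Y → sqd x y < δ → sqd p x ≤ sqd p y}

/-- The local minimum values on `Y` of the squared distance to `p`, as a subset of `ℝ^1`. -/
def localMinValues {n : ℕ} (p : Fin n → ℝ) (Y : Set (Fin n → ℝ)) : Set (Fin 1 → ℝ) :=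
  {s | ∃ x, x ∈ localMinima p Y ∧ sqd p x = s 0}

/-- The points of `X` whose squared distance to the frontier of `X` is at least `ε`. -/
def core {n : ℕ} (ε : ℝ) (X : Set (Fin n → ℝ)) : Set (Fin n → ℝ) :=
  {x | x ∈ X ∧ ∀ y, (y ∈ closure X ∧ y ∉ X) → ε ≤ sqd x y}

section Topology

variable {n : ℕ}

theorem exists_isOpen_of_continuousOn {X : Set (Fin n → ℝ)} {g : (Fin n → ℝ) → ℕ}
    (hg : ContinuousOn g X) {x : Fin n → ℝ} (hx : x ∈ X) :
    ∃ O, IsOpen O ∧ x ∈ O ∧ ∀ y ∈ O ∩ X, g y = g x := by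
  obtain ⟨O, hO, hxO, hsub⟩ := mem_nhdsWithin.1 (hg x hx (IsOpen.mem_nhds
    (isOpen_discrete {g x}) rfl))
  exact ⟨O, hO, hxO, fun y hy => hsub hy⟩

/-- Two disjoint closed sets have different distances to a generic point `p`: if `a` is a point
of `K₁` nearest to `p` and `p` moves towards `a`, then the distance to `K₁` decreases at full speed,
whereas the distance to `K₂` does so only if `a` belongs to `K₂`. -/
theorem interior_infDist_eq {E : Type*} [NormedAddCommGroup E] [InnerProductSpace ℝ E]
    [ProperSpace E] {K₁ K₂ : Set E} (h₁ : IsClosed K₁) (h₂ : IsClosed K₂) (hne₁ : K₁.Nonempty)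
    (hne₂ : K₂.Nonempty) (hd : Disjoint K₁ K₂) :
    interior {p | Metric.infDist p K₁ = Metric.infDist p K₂} = ∅ := by
  rw [Set.eq_empty_iff_forall_notMem]
  intro p hp
  have hpS : p ∈ {p | Metric.infDist p K₁ = Metric.infDist p K₂} := interior_subset hp
  have hpeq : Metric.infDist p K₁ = Metric.infDist p K₂ := hpS
  obtain ⟨a, ha, hpa⟩ := h₁.exists_infDist_eq_dist hne₁ p
  have hcont : ContinuousAt (fun t : ℝ => p + t • (a - p)) 0 := by fun_prop
  have hev : ∀ᶠ t : ℝ in nhdsWithin 0 (Set.Ioi 0),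
      p + t • (a - p) ∈ {p | Metric.infDist p K₁ = Metric.infDist p K₂} := by
    have h0 : {p | Metric.infDist p K₁ = Metric.infDist p K₂} ∈ nhds (p + (0 : ℝ) • (a - p)) := by
      simpa only [zero_smul, add_zero] using mem_interior_iff_mem_nhds.1 hp
    exact nhdsWithin_le_nhds (hcont.eventually h0)
  obtain ⟨t, ht, ht0, ht1⟩ :=
    (hev.and (Ioo_mem_nhdsGT (show (0 : ℝ) < 1 by norm_num))).exists
  obtain ⟨b, hb, htb⟩ := h₂.exists_infDist_eq_dist hne₂ (p + t • (a - p))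
  have e1 : ‖(b - p) - t • (a - p)‖ ≤ (1 - t) * ‖a - p‖ := by
    have h := Metric.infDist_le_dist_of_mem (x := p + t • (a - p)) ha
    rw [ht, htb, dist_eq_norm, dist_eq_norm] at h
    have r1 : p + t • (a - p) - b = -((b - p) - t • (a - p)) := by abel
    have r2 : p + t • (a - p) - a = -((1 - t) • (a - p)) := by module
    rwa [r1, r2, norm_neg, norm_neg, norm_smul, Real.norm_of_nonneg (by linarith)] at h
  have e2 : ‖a - p‖ ≤ ‖b - p‖ := by
    have h := Metric.infDist_le_dist_of_mem (x := p) hb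
    rwa [← hpeq, hpa, dist_comm, dist_comm p, dist_eq_norm, dist_eq_norm] at h
  have e3 : ‖(b - p) - (a - p)‖ ^ 2 ≤ 0 := by
    have h1 := pow_le_pow_left₀ (norm_nonneg _) e1 2
    have h2 := pow_le_pow_left₀ (norm_nonneg _) e2 2
    rw [@norm_sub_sq_real, norm_smul, inner_smul_right, Real.norm_of_nonneg ht0.le] at h1
    rw [@norm_sub_sq_real]
    -- with `s` the inner product of `b - p` and `a - p`, first `‖a - p‖² ≤ s`
    have h3 : ‖a - p‖ ^ 2 ≤ inner ℝ (b - p) (a - p) := by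
      by_contra hcon
      nlinarith
    nlinarith
  have hab : b = a := by
    have : ‖(b - p) - (a - p)‖ = 0 := by
      have := norm_nonneg ((b - p) - (a - p))
      nlinarith
    rw [norm_eq_zero] at this
    exact sub_left_injective (sub_eq_zero.1 this)
  exact Set.disjoint_left.1 hd ha (hab ▸ hb)

theorem exists_injective_infDist {E : Type*} [NormedAddCommGroup E] [InnerProductSpace ℝ E]
    [ProperSpace E] {ι : Type*} [Finite ι] {K : ι → Set E} (hK : ∀ i, IsClosed (K i))
    (hne : ∀ i, (K i).Nonempty) (hd : Pairwise fun i j => Disjoint (K i) (K j)) :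
    ∃ p, Function.Injective fun i => Metric.infDist p (K i) := by
  have hdense : Dense (⋂ q : {q : ι × ι // q.1 ≠ q.2},
      {p | Metric.infDist p (K q.1.1) = Metric.infDist p (K q.1.2)}ᶜ) := by
    refine dense_iInter_of_isOpen (fun q => ?_) fun q => ?_
    · exact (isClosed_eq (Metric.continuous_infDist_pt _)
        (Metric.continuous_infDist_pt _)).isOpen_compl
    · exact interior_eq_empty_iff_dense_compl.1
        (interior_infDist_eq (hK _) (hK _) (hne _) (hne _) (hd q.2))
  obtain ⟨p, hp⟩ := hdense.nonempty
  refine ⟨p, fun i j hij => ?_⟩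
  by_contra hne'
  exact Set.mem_iInter.1 hp ⟨(i, j), hne'⟩ hij

/-- A local minimum value is the least value on a ball of a countable basis. -/
theorem countable_localMinValues (p : Fin n → ℝ) (Y : Set (Fin n → ℝ)) :
    (localMinValues p Y).Countable := by
  have hsub : localMinValues p Y ⊆
      ⋃ q, {s | IsLeast (sqd p '' (Y ∩ basicBall n q)) (s 0)} := by
    rintro s ⟨x, ⟨hx, δ, hδ, hmin⟩, hs⟩
    obtain ⟨O, hOδ, hO, hxO⟩ := mem_nhds_iff.1 ((hasBasis_nhds_sqd x).mem_of_mem hδ)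
    obtain ⟨q, hxq, hqO⟩ := exists_basicBall hO hxO
    refine Set.mem_iUnion.2 ⟨q, ⟨x, ⟨hx, hxq⟩, hs⟩, ?_⟩
    rintro _ ⟨y, ⟨hy, hyq⟩, rfl⟩
    exact hs ▸ hmin y hy (hOδ (hqO hyq))
  refine (Set.countable_iUnion fun q => Set.Subsingleton.countable ?_).mono hsub
  intro s hs s' hs'
  exact funext fun j => by rw [Fin.fin_one_eq_zero j]; exact hs.unique hs'

theorem card_le_of_countable {A : Set (Fin n → ℝ)} {N : ℝ} (hA : A.Countable)
    (h : HasAtMostComponents A N) {ι : Type*} [Finite ι] (f : ι → (Fin n → ℝ))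
    (hf : Function.Injective f) (hfA : ∀ i, f i ∈ A) : (Nat.card ι : ℝ) ≤ N := by
  have := h.1
  have : TotallyDisconnectedSpace A := totallyDisconnectedSpace_subtype_iff.2
    hA.isTotallyDisconnected
  refine le_trans ?_ h.2
  refine Nat.cast_le.2 (Nat.card_le_card_of_injective
    (fun i => ConnectedComponents.mk (⟨f i, hfA i⟩ : A)) fun i j hij => ?_)
  simp only [ConnectedComponents.coe_eq_coe, connectedComponent_eq_singleton,
    Set.singleton_eq_singleton_iff, Subtype.mk.injEq] at hij
  exact hf hij

theorem sqd_ofLp (p x : EuclideanSpace ℝ (Fin n)) : sqd p.ofLp x.ofLp = dist p x ^ 2 := by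
  rw [EuclideanSpace.dist_eq, Real.sq_sqrt (by positivity)]
  simp [sqd, Real.dist_eq]

/-- The pieces of a closed set `Y` have different distances to a generic point `p`, and these
distances are attained at local minima. There are only countably many local minimum values, whence
each of them is a connected component of the set of all. -/
theorem piecesLE_of_isClosed {Y : Set (Fin n → ℝ)} (hY : IsClosed Y) {N : ℝ}
    (h : ∀ p, HasAtMostComponents (localMinValues p Y) N) : PiecesLE Y N := by
  intro g hg T hT
  let K : T → Set (EuclideanSpace ℝ (Fin n)) := fun c => WithLp.ofLp ⁻¹' (Y ∩ g ⁻¹' {c.1})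
  have hK : ∀ c, IsClosed (K c) := fun c =>
    (hg.preimage_isClosed_of_isClosed hY (isClosed_discrete _)).preimage
      (PiLp.continuous_ofLp 2 _)
  have hne : ∀ c, (K c).Nonempty := by
    intro c
    obtain ⟨x, hx, hxc⟩ := hT c.2
    exact ⟨WithLp.toLp 2 x, hx, hxc⟩
  have hd : Pairwise fun c c' => Disjoint (K c) (K c') := by
    intro c c' hcc
    refine Set.disjoint_left.2 fun x hx hx' => hcc (Subtype.ext ?_)
    exact hx.2.symm.trans hx'.2
  obtain ⟨p, hp⟩ := exists_injective_infDist hK hne hd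
  have := card_le_of_countable (countable_localMinValues p.ofLp Y) (h p.ofLp)
    (fun c : T => fun _ => Metric.infDist p (K c) ^ 2) ?_ ?_
  · simpa using this
  · intro c c' hcc
    refine hp ?_
    exact (sq_eq_sq₀ Metric.infDist_nonneg Metric.infDist_nonneg).1 (congrFun hcc 0)
  · intro c
    obtain ⟨a, ha, hpa⟩ := (hK c).exists_infDist_eq_dist (hne c) p
    obtain ⟨O, hO, haO, hOc⟩ := exists_isOpen_of_continuousOn hg ha.1
    obtain ⟨δ, hδ, hδO⟩ := (hasBasis_nhds_sqd a.ofLp).mem_iff.1 (hO.mem_nhds haO)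
    refine ⟨a.ofLp, ⟨ha.1, δ, hδ, fun y hy hay => ?_⟩, ?_⟩
    · have hyK : WithLp.toLp 2 y ∈ K c := ⟨hy, (hOc y ⟨hδO hay, hy⟩).trans ha.2⟩
      have := sqd_ofLp p (WithLp.toLp 2 y)
      rw [WithLp.ofLp_toLp] at this
      rw [sqd_ofLp, this]
      refine pow_le_pow_left₀ dist_nonneg ?_ 2
      rw [← hpa]
      exact Metric.infDist_le_dist_of_mem hyK
    · rw [sqd_ofLp, hpa]

theorem isClosed_core {ε : ℝ} (hε : 0 < ε) (X : Set (Fin n → ℝ)) : IsClosed (core ε X) := by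
  refine isClosed_of_closure_subset fun x hx => ?_
  have hfr : ∀ y, (y ∈ closure X ∧ y ∉ X) → ε ≤ sqd x y := by
    intro y hy
    have hcl : IsClosed {x : Fin n → ℝ | ε ≤ sqd x y} := by
      refine isClosed_le continuous_const ?_
      unfold sqd
      fun_prop
    exact closure_minimal (fun z hz => hz.2 y hy) hcl hx
  refine ⟨?_, hfr⟩
  by_contra hxX
  have := hfr x ⟨closure_mono (fun z hz => hz.1) hx, hxX⟩
  rw [sqd_eq_zero.2 rfl] at this
  linarith

/-- The cores of `X` are closed and exhaust the set of points at which `X` is locally closed. -/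
theorem piecesLE_sdiff_badPart {X : Set (Fin n → ℝ)} {N : ℝ}
    (h : ∀ ε, 0 < ε → PiecesLE (core ε X) N) : PiecesLE (X \ badPart X) N := by
  intro g hg T hT
  have hsub : ∀ ε, 0 < ε → core ε X ⊆ X \ badPart X := by
    rintro ε hε x ⟨hx, hfr⟩
    refine ⟨hx, fun hbad => ?_⟩
    obtain ⟨y, hy, hxy⟩ := (mem_closure_iff_nhds_basis (hasBasis_nhds_sqd x)).1 hbad.2 ε hε
    exact absurd (hfr y hy) (not_le.2 hxy)
  have hev : ∀ c ∈ T, ∀ᶠ ε in nhdsWithin (0 : ℝ) (Set.Ioi 0), c ∈ g '' core ε X := by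
    intro c hc
    obtain ⟨x, ⟨hx, hbad⟩, rfl⟩ := hT hc
    have hxcl : x ∉ closure (closure X \ X) := fun h => hbad ⟨hx, h⟩
    rw [mem_closure_iff_nhds_basis (hasBasis_nhds_sqd x)] at hxcl
    push Not at hxcl
    obtain ⟨δ, hδ, hfr⟩ := hxcl
    filter_upwards [Ioo_mem_nhdsGT hδ] with ε hε
    exact ⟨x, ⟨hx, fun y hy => hε.2.le.trans (not_lt.1 (hfr y hy))⟩, rfl⟩
  obtain ⟨ε, hε, hε0⟩ :=
    (((Filter.eventually_all_finset T).2 hev).and self_mem_nhdsWithin).exists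
  exact h ε hε0 g (hg.mono (hsub ε hε0)) T fun c hc => hε c hc

theorem piecesLE_empty : PiecesLE (∅ : Set (Fin n → ℝ)) 0 := by
  intro g _ T hT
  simp_all

theorem PiecesLE.mono {X : Set (Fin n → ℝ)} {N M : ℝ} (h : PiecesLE X N) (hNM : N ≤ M) :
    PiecesLE X M := fun g hg T hT => (h g hg T hT).trans hNM

theorem PiecesLE.of_sdiff {X Y : Set (Fin n → ℝ)} {N M : ℝ} (hYX : Y ⊆ X)
    (h : PiecesLE (X \ Y) N) (h' : PiecesLE Y M) : PiecesLE X (N + M) := by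
  classical
  intro g hg T hT
  have h1 := h g (hg.mono Set.sdiff_subset) (T.filter (· ∈ g '' (X \ Y)))
    fun c hc => (Finset.mem_filter.1 hc).2
  have h2 := h' g (hg.mono hYX) (T.filter (· ∈ g '' Y))
    fun c hc => (Finset.mem_filter.1 hc).2
  refine le_trans ?_ (add_le_add h1 h2)
  rw [← Nat.cast_add]
  refine Nat.cast_le.2 (le_trans (Finset.card_le_card fun c hc => ?_) (Finset.card_union_le _ _))
  obtain ⟨x, hx, rfl⟩ := hT hc
  rw [Finset.mem_union, Finset.mem_filter, Finset.mem_filter]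
  by_cases hxY : x ∈ Y
  · exact Or.inr ⟨hc, x, hxY, rfl⟩
  · exact Or.inl ⟨hc, x, ⟨hx, hxY⟩, rfl⟩

theorem piecesLE_of_badPart_iterate (m : ℕ) {X : Set (Fin n → ℝ)} (hX : badPart^[m] X = ∅)
    {N : ℕ → ℝ} (h : ∀ k < m, PiecesLE (badPart^[k] X \ badPart^[k + 1] X) (N k)) :
    PiecesLE X (∑ k ∈ Finset.range m, N k) := by
  induction m generalizing X N with
  | zero =>
    obtain rfl : X = ∅ := hX
    simpa using piecesLE_empty
  | succ m ih =>
    rw [Finset.sum_range_succ', add_comm]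
    exact PiecesLE.of_sdiff (fun x hx => hx.1) (h 0 m.succ_pos)
      (ih hX (N := fun k => N (k + 1)) fun k hk => h (k + 1) (Nat.succ_lt_succ hk))

/-- A locally constant function with as many values as possible is constant only on the connected
components: otherwise a level set could be split. -/
theorem PiecesLE.hasAtMostComponents {X : Set (Fin n → ℝ)} {N : ℝ} (h : PiecesLE X N) :
    HasAtMostComponents X N := by
  classical
  let p : ℕ → Prop := fun m => ∃ g : (Fin n → ℝ) → ℕ, ContinuousOn g X ∧
    ∃ T : Finset ℕ, (T : Set ℕ) ⊆ g '' X ∧ T.card = m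
  have hbound : ∀ m, p m → m ≤ ⌊N⌋₊ := by
    rintro _ ⟨g, hg, T, hT, rfl⟩
    exact Nat.le_floor (h g hg T hT)
  have hp0 : p 0 := ⟨fun _ => 0, continuousOn_const, ∅, by simp, rfl⟩
  obtain ⟨g, hg, T, hT, hcard⟩ := Nat.findGreatest_spec (P := p) (Nat.zero_le ⌊N⌋₊) hp0
  have hmax : ∀ m, p m → m ≤ T.card := fun m hm =>
    hcard ▸ Nat.le_findGreatest (hbound m hm) hm
  -- all values of `g` lie in `T`
  have hval : ∀ x ∈ X, g x ∈ T := by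
    intro x hx
    by_contra hxT
    have := hmax _ ⟨g, hg, insert (g x) T, by
      rw [Finset.coe_insert]
      exact Set.insert_subset ⟨x, hx, rfl⟩ hT, rfl⟩
    rw [Finset.card_insert_of_notMem hxT] at this
    omega
  have hconn : ∀ c, IsPreconnected (X ∩ g ⁻¹' {c}) := by
    intro c
    refine isPreconnected_of_forall_constant fun f hf x hx y hy => ?_
    by_contra hxy
    wlog hfx : f x = true generalizing x y
    · refine this y hy x hx (Ne.symm hxy) ?_
      cases hx' : f x <;> cases hy' : f y <;> simp_all
    have hfy : f y = false := by
      cases hy' : f y <;> simp_all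
    -- split the level set, using a new value on one of the two parts
    obtain ⟨M, hM⟩ := Infinite.exists_notMem_finset T
    let g' : (Fin n → ℝ) → ℕ := fun z => if g z = c ∧ f z = true then M else g z
    have hg' : ContinuousOn g' X := by
      intro z hz
      obtain ⟨O, hO, hzO, hOg⟩ := exists_isOpen_of_continuousOn hg hz
      have hev : ∀ᶠ w in nhdsWithin z X, g' w = g' z := by
        by_cases hzc : g z = c
        · have hfz : ∀ᶠ w in nhdsWithin z (X ∩ g ⁻¹' {c}), f w = f z :=
            hf z ⟨hz, hzc⟩ (IsOpen.mem_nhds (isOpen_discrete {f z}) rfl)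
          rw [eventually_nhdsWithin_iff] at hfz ⊢
          filter_upwards [hfz, hO.mem_nhds hzO] with w hw hwO hwX
          have hgw := hOg w ⟨hwO, hwX⟩
          simp only [g', hgw, hw ⟨hwX, hgw.trans hzc⟩]
        · rw [eventually_nhdsWithin_iff]
          filter_upwards [hO.mem_nhds hzO] with w hwO hwX
          have hgw := hOg w ⟨hwO, hwX⟩
          simp [g', hgw, hzc]
      exact (continuousWithinAt_const (b := g' z)).congr_of_eventuallyEq hev rfl
    have := hmax _ ⟨g', hg', insert M T, by
      rw [Finset.coe_insert]
      refine Set.insert_subset ⟨x, hx.1, if_pos ⟨hx.2, hfx⟩⟩ fun d hd => ?_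
      by_cases hdc : d = c
      · exact ⟨y, hy.1, by simpa [g', hfy, hdc] using hy.2⟩
      · obtain ⟨z, hz, rfl⟩ := hT hd
        exact ⟨z, hz, by simp [g', hdc]⟩, rfl⟩
    rw [Finset.card_insert_of_notMem hM] at this
    omega
  have hgc : Continuous fun x : X => g x := continuousOn_iff_continuous_domRestrict.1 hg
  let G : ConnectedComponents X → T := fun C => ⟨hgc.connectedComponentsLift C, by
    obtain ⟨x, rfl⟩ := ConnectedComponents.surjective_coe C
    rw [hgc.connectedComponentsLift_apply_coe]
    exact hval x x.2⟩
  have hG : Function.Injective G := by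
    intro C C' hCC
    obtain ⟨x, rfl⟩ := ConnectedComponents.surjective_coe C
    obtain ⟨y, rfl⟩ := ConnectedComponents.surjective_coe C'
    have hxy : g x = g y := by
      simpa only [G, hgc.connectedComponentsLift_apply_coe] using congrArg Subtype.val hCC
    have hpre : IsPreconnected (Subtype.val ⁻¹' (X ∩ g ⁻¹' {g y}) : Set X) := by
      refine Topology.IsInducing.subtypeVal.isPreconnected_image.1 ?_
      rw [Subtype.image_preimage_coe, ← Set.inter_assoc, Set.inter_self]
      exact hconn _
    rw [ConnectedComponents.coe_eq_coe']
    exact hpre.subset_connectedComponent ⟨y.2, rfl⟩ ⟨x.2, hxy⟩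
  refine ⟨Finite.of_injective G hG, le_trans (Nat.cast_le.2 ?_) (h g hg T hT)⟩
  simpa using Nat.card_le_card_of_injective G hG

end Topology

/-! ### Polynomials with nonnegative coefficients -/

section Coeffs

open Polynomial

variable {P Q : ℝ[X]}

theorem PositiveCoeffs.zero : PositiveCoeffs 0 := fun i => by simp

theorem PositiveCoeffs.add (hP : PositiveCoeffs P) (hQ : PositiveCoeffs Q) :
    PositiveCoeffs (P + Q) := fun i => by
  rw [coeff_add]
  exact add_nonneg (hP i) (hQ i)

theorem PositiveCoeffs.mul (hP : PositiveCoeffs P) (hQ : PositiveCoeffs Q) :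
    PositiveCoeffs (P * Q) := fun i => by
  rw [coeff_mul]
  exact Finset.sum_nonneg fun _ _ => mul_nonneg (hP _) (hQ _)

theorem PositiveCoeffs.C {c : ℝ} (hc : 0 ≤ c) : PositiveCoeffs (C c) := fun i => by
  rw [coeff_C]
  split_ifs <;> simp [hc]

theorem PositiveCoeffs.pow (hP : PositiveCoeffs P) (k : ℕ) : PositiveCoeffs (P ^ k) := by
  induction k with
  | zero => simpa using PositiveCoeffs.C zero_le_one
  | succ k ih => exact pow_succ P k ▸ ih.mul hP

theorem PositiveCoeffs.sum {ι : Type*} {s : Finset ι} {p : ι → ℝ[X]}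
    (hp : ∀ i ∈ s, PositiveCoeffs (p i)) : PositiveCoeffs (∑ i ∈ s, p i) :=
  Finset.sum_induction p PositiveCoeffs (fun _ _ => PositiveCoeffs.add) .zero hp

theorem PositiveCoeffs.comp (hP : PositiveCoeffs P) (hQ : PositiveCoeffs Q) :
    PositiveCoeffs (P.comp Q) := by
  rw [comp_eq_sum_left]
  exact PositiveCoeffs.sum fun i _ => (PositiveCoeffs.C (hP i)).mul (hQ.pow i)

theorem PositiveCoeffs.eval_nonneg (hP : PositiveCoeffs P) (D : ℕ) : 0 ≤ P.eval (D : ℝ) := by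
  rw [eval_eq_sum_range]
  exact Finset.sum_nonneg fun i _ => mul_nonneg (hP i) (by positivity)

theorem positiveCoeffs_map_natCast (P : ℕ[X]) :
    PositiveCoeffs (P.map (Nat.castRingHom ℝ)) := fun i => by
  simp [coeff_map]

end Coeffs

/-! ### The bound -/

namespace IsPresharp

variable {L : FirstOrder.Language.{u, v}} [L.Structure ℝ] {Ω : Family}
  {I : Type*} {deg : I → ℕ} {n : ℕ}

theorem tame_core (hΩ : IsPresharp L Ω) {X : I → Set (Fin n → ℝ)}
    (hX : Tame Ω deg fun i x => x ∈ X i) (ε : I → ℝ) :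
    Tame Ω deg fun i x => x ∈ core (ε i) (X i) :=
  hΩ.tame_and hX (hΩ.tame_forallVec (hΩ.tame_imp
    (hΩ.tame_and (hΩ.tame_mem (hΩ.tame_closure hX) _) (hΩ.tame_not (hΩ.tame_mem hX _)))
    (hΩ.tame_le (.const _) (.sqd (fun _ => .coord _) fun _ => .coord _))))

theorem tame_localMinValues (hΩ : IsPresharp L Ω) {Y : I → Set (Fin n → ℝ)}
    (hY : Tame Ω deg fun i x => x ∈ Y i) (p : I → (Fin n → ℝ)) :
    Tame Ω deg fun i s => s ∈ localMinValues (p i) (Y i) := by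
  have hmin : Tame Ω deg fun i x => x ∈ localMinima (p i) (Y i) :=
    hΩ.tame_and hY (hΩ.tame_exists (hΩ.tame_and (hΩ.tame_lt (.const _) (.coord _))
      (hΩ.tame_forallVec (hΩ.tame_imp (hΩ.tame_mem hY _) (hΩ.tame_imp
        (hΩ.tame_lt (.sqd (fun _ => .coord _) fun _ => .coord _) (.coord _))
        (hΩ.tame_le (.sqd (fun j => .const fun i => p i j) fun _ => .coord _)
          (.sqd (fun j => .const fun i => p i j) fun _ => .coord _)))))))
  exact hΩ.tame_existsVec (hΩ.tame_and (hΩ.tame_mem hmin _)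
    (hΩ.tame_eq (.sqd (fun j => .const fun i => p i j) fun _ => .coord _) (.coord _)))

/-- The bound on the number of components of subsets of `ℝ^1`, for tame families. -/
theorem exists_hasAtMostComponents (hΩ : IsPresharp L Ω) {A : I → Set (Fin 1 → ℝ)}
    (hA : Tame Ω deg fun i s => s ∈ A i) :
    ∃ Q : Polynomial ℝ, PositiveCoeffs Q ∧
      ∀ i, HasAtMostComponents (A i) (Q.eval (deg i : ℝ)) := by
  obtain ⟨F, P, h⟩ := hA
  obtain ⟨Q, hQ, hQ'⟩ := hΩ.components F
  refine ⟨Q.comp (P.map (Nat.castRingHom ℝ)), hQ.comp (positiveCoeffs_map_natCast P), fun i => ?_⟩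
  have := hQ' _ _ (h i)
  rwa [Polynomial.eval_comp, Polynomial.eval_natCast_map]

/-- The level `ε` of the core and the base point `p` of the distance enter only through constants
of polynomials, so the bound does not depend on them. -/
theorem exists_piecesLE_sdiff_badPart (hΩ : IsPresharp L Ω) {X : I → Set (Fin n → ℝ)}
    (hX : Tame Ω deg fun i x => x ∈ X i) :
    ∃ Q : Polynomial ℝ, PositiveCoeffs Q ∧
      ∀ i, PiecesLE (X i \ badPart (X i)) (Q.eval (deg i : ℝ)) := by
  let J := I × ℝ × (Fin n → ℝ)
  have hX' : Tame Ω (fun a : J => deg a.1) fun a x => x ∈ X a.1 := by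
    obtain ⟨F, P, h⟩ := hX
    exact ⟨F, P, fun a => h a.1⟩
  obtain ⟨Q, hQ, hQ'⟩ := hΩ.exists_hasAtMostComponents
    (hΩ.tame_localMinValues (hΩ.tame_core hX' fun a => a.2.1) fun a => a.2.2)
  exact ⟨Q, hQ, fun i => piecesLE_sdiff_badPart fun ε hε =>
    piecesLE_of_isClosed (isClosed_core hε _) fun p => hQ' (i, ε, p)⟩

/-- The number of locally closed pieces depends only on `n`, and each of them runs through a tame
family. -/
theorem exists_piecesLE (hΩ : IsPresharp L Ω) {X : I → Set (Fin n → ℝ)}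
    (hX : Tame Ω deg fun i x => x ∈ X i) :
    ∃ Q : Polynomial ℝ, PositiveCoeffs Q ∧ ∀ i, PiecesLE (X i) (Q.eval (deg i : ℝ)) := by
  choose Q hQ hQ' using fun k => hΩ.exists_piecesLE_sdiff_badPart (hΩ.tame_badPart_iterate hX k)
  refine ⟨∑ k ∈ Finset.range (n + 1), Q k, .sum fun k _ => hQ k, fun i => ?_⟩
  rw [Polynomial.eval_finsetSum]
  refine piecesLE_of_badPart_iterate (n + 1)
    (hΩ.badPart_iterate_eq_empty (hX.defSet i)) fun k _ => ?_
  rw [Function.iterate_succ_apply']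
  exact hQ' k i

end IsPresharp

end Presharp

theorem mainTheorem6 (L : FirstOrder.Language.{u, v}) [L.Structure ℝ] (Ω : Presharp.Family)
    (hΩ : Presharp.IsPresharp L Ω) (F : ℕ) :
    ∃ P : Polynomial ℝ, Presharp.PositiveCoeffs P ∧
      ∀ (D ℓ : ℕ) (X : Set (Fin ℓ → ℝ)), X ∈ Ω F D ℓ →
        Presharp.HasAtMostComponents X (P.eval (D : ℝ)) := by
  -- the family of all sets of format `F` in `ℝ^ℓ`, together with their degrees
  have htame : ∀ ℓ, Presharp.Tame Ω
      (fun a : {a : ℕ × Set (Fin ℓ → ℝ) // a.2 ∈ Ω F a.1 ℓ} => a.1.1)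
      fun a x => x ∈ a.1.2 := fun ℓ => ⟨F, Polynomial.X, fun a => by simpa using a.2⟩
  choose Q hQ hQ' using fun ℓ => hΩ.exists_piecesLE (htame ℓ)
  refine ⟨∑ ℓ ∈ Finset.range (F + 1), Q ℓ, .sum fun ℓ _ => hQ ℓ, fun D ℓ X hX => ?_⟩
  refine ((hQ' ℓ ⟨(D, X), hX⟩).mono ?_).hasAtMostComponents
  rw [Polynomial.eval_finsetSum]
  exact Finset.single_le_sum (f := fun ℓ => (Q ℓ).eval (D : ℝ))
    (fun ℓ _ => (hQ ℓ).eval_nonneg D)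
    (Finset.mem_range.2 (Nat.lt_succ_of_le (hΩ.le_format F D ℓ X hX)))
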